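/- Let $G=(V,E)$ be a finite simple graph (for instance the complete graph on a set of agents) with success probabilities $p_e\in[0,1]$, $e\in E$, which are known. Each edge $e$ is successful with probability $p_e$, independently of the other edges; the outcome is unknown at first, becomes known when $e$ is first selected, and never changes. In each of $T$ rounds an online algorithm selects a matching of $G$, as a function of the edges selected in earlier rounds and of their outcomes. Its reward is $\sum_{t=1}^{T} w_t R_t$, where $w_1,\dots,w_T\ge 0$ are given weights and $R_t$ is the number of successful edges in the matching selected in round $t$. Let $\mathrm{OPT}$ be the maximum expected reward over all online algorithms. The algorithm Greedy-Commit selects in round $t$ the matching $A_t\cup M_t$, where $A_t$ is the set of all edges already known to be successful, and $M_t$ is a matching of $G$ between vertices that are not covered by $A_t$, chosen to maximize $\sum_{e\in M_t} p^{(t)}_e$; here $p^{(t)}_e=0$ if $e$ is already known to be unsuccessful, and $p^{(t)}_e=p_e$ otherwise. Ties are broken arbitrarily. Then, for every such instance and every tie-breaking, the expected reward of Greedy-Commit is at least $0.43\cdot\mathrm{OPT}$. -/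

import Mathlib

namespace RepeatedMatching

section

variable {V : Type*} [Fintype V] [DecidableEq V]

/-- A finite set of edges of `G`, no two of which share an endpoint. -/
def IsMatching (G : SimpleGraph V) [DecidableRel G.Adj] (M : Finset (Sym2 V)) : Prop :=
  M ⊆ G.edgeFinset ∧ ∀ e ∈ M, ∀ f ∈ M, e ≠ f → ∀ v, v ∈ e → v ∉ f

/-- What has been observed so far, most recent round first: for every past round, the set of
edges selected in that round and the subset of those that turned out to be successful. -/
abbrev History (V : Type*) := List (Finset (Sym2 V) × Finset (Sym2 V))

/-- The history after `t` rounds if the edges are selected by the rule `select` and the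
set of successful (compatible) edges is `S`. The outcome of an edge persists over the rounds. -/
def run (select : History V → Finset (Sym2 V)) (S : Finset (Sym2 V)) : ℕ → History V
  | 0 => []
  | t + 1 =>
      (select (run select S t), select (run select S t) ∩ S) :: run select S t

/-- An online algorithm: in each round it selects a matching, as a function of
what has been observed in the previous rounds. -/
structure OnlineAlgorithm (G : SimpleGraph V) [DecidableRel G.Adj] where
  select : History V → Finset (Sym2 V)
  isMatching : ∀ S ⊆ G.edgeFinset, ∀ t, IsMatching G (select (run select S t))

/-- The probability that the set of successful edges is exactly `S`, each edge `e` being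
successful with probability `p e`, independently of the others. -/
def sampleProb (G : SimpleGraph V) [DecidableRel G.Adj] (p : Sym2 V → ℝ)
    (S : Finset (Sym2 V)) : ℝ :=
  (∏ e ∈ S, p e) * ∏ e ∈ G.edgeFinset \ S, (1 - p e)

/-- The weighted sum, over the rounds `0, …, T - 1`, of the number of successful edges that are
selected in the round, when the set of successful edges is `S`. -/
def OnlineAlgorithm.reward {G : SimpleGraph V} [DecidableRel G.Adj] (alg : OnlineAlgorithm G)
    (T : ℕ) (w : ℕ → ℝ) (S : Finset (Sym2 V)) : ℝ :=
  ∑ t ∈ Finset.range T, w t * ((alg.select (run alg.select S t) ∩ S).card : ℝ)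

/-- The expected reward of an online algorithm. -/
def OnlineAlgorithm.expectedReward {G : SimpleGraph V} [DecidableRel G.Adj]
    (alg : OnlineAlgorithm G) (p : Sym2 V → ℝ) (T : ℕ) (w : ℕ → ℝ) : ℝ :=
  ∑ S ∈ G.edgeFinset.powerset, sampleProb G p S * alg.reward T w S

/-- The expected reward of the optimal online algorithm. -/
noncomputable def optReward (G : SimpleGraph V) [DecidableRel G.Adj] (p : Sym2 V → ℝ)
    (T : ℕ) (w : ℕ → ℝ) : ℝ :=
  ⨆ alg : OnlineAlgorithm G, alg.expectedReward p T w

/-- The supremum in `optReward` is over a bounded set, hence it is an upper bound. -/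
theorem expectedReward_le_optReward {G : SimpleGraph V} [DecidableRel G.Adj]
    (p : Sym2 V → ℝ) (T : ℕ) (w : ℕ → ℝ) (alg : OnlineAlgorithm G) :
    alg.expectedReward p T w ≤ optReward G p T w := by
  refine le_ciSup (f := fun a : OnlineAlgorithm G => a.expectedReward p T w) ?_ alg
  refine ⟨∑ S ∈ G.edgeFinset.powerset, |sampleProb G p S| *
    ∑ t ∈ Finset.range T, |w t| * (G.edgeFinset.card : ℝ), ?_⟩
  rintro _ ⟨a, rfl⟩
  refine Finset.sum_le_sum fun S hS => ?_
  refine (le_abs_self _).trans ?_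
  rw [abs_mul]
  refine mul_le_mul_of_nonneg_left ?_ (abs_nonneg _)
  refine (Finset.abs_sum_le_sum_abs _ _).trans (Finset.sum_le_sum fun t _ => ?_)
  rw [abs_mul, Nat.abs_cast]
  refine mul_le_mul_of_nonneg_left ?_ (abs_nonneg _)
  exact_mod_cast Finset.card_le_card
    (Finset.inter_subset_right.trans (Finset.mem_powerset.1 hS))

/-- The edges that have been observed to be successful. -/
def knownSuccesses : History V → Finset (Sym2 V)
  | [] => ∅
  | r :: h => r.2 ∪ knownSuccesses h

/-- The edges that have been observed to be unsuccessful. -/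
def knownFailures : History V → Finset (Sym2 V)
  | [] => ∅
  | r :: h => (r.1 \ r.2) ∪ knownFailures h

/-- The success probabilities, set to zero on the edges that are known to be unsuccessful. -/
def residualProb (p : Sym2 V → ℝ) (h : History V) (e : Sym2 V) : ℝ :=
  if e ∈ knownFailures h then 0 else p e

/-- A matching between the vertices that are not covered by the known successful edges. -/
def IsFreeMatching (G : SimpleGraph V) [DecidableRel G.Adj] (h : History V)
    (M : Finset (Sym2 V)) : Prop :=
  IsMatching G M ∧ ∀ e ∈ M, ∀ v ∈ e, ∀ f ∈ knownSuccesses h, v ∉ f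

/-- A way to choose, after every history, a matching of maximum weight between the remaining
vertices; the rules differ only in how they break ties. -/
structure MaxWeightRule (G : SimpleGraph V) [DecidableRel G.Adj] (p : Sym2 V → ℝ) where
  choose : History V → Finset (Sym2 V)
  isFreeMatching : ∀ h, IsFreeMatching G h (choose h)
  maximal : ∀ h M, IsFreeMatching G h M →
    ∑ e ∈ M, residualProb p h e ≤ ∑ e ∈ choose h, residualProb p h e

instance instNonemptyMaxWeightRule (G : SimpleGraph V) [DecidableRel G.Adj] (p : Sym2 V → ℝ) :
    Nonempty (MaxWeightRule G p) := by
  classical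
  have key : ∀ h : History V, ∃ M, IsFreeMatching G h M ∧ ∀ N, IsFreeMatching G h N →
      ∑ e ∈ N, residualProb p h e ≤ ∑ e ∈ M, residualProb p h e := by
    intro h
    obtain ⟨M, hM, hmax⟩ := Finset.exists_max_image
      (Finset.univ.filter fun M : Finset (Sym2 V) => IsFreeMatching G h M)
      (fun M => ∑ e ∈ M, residualProb p h e)
      ⟨∅, Finset.mem_filter.2 ⟨Finset.mem_univ _, by simp [IsFreeMatching, IsMatching]⟩⟩
    exact ⟨M, (Finset.mem_filter.1 hM).2,
      fun N hN => hmax N (Finset.mem_filter.2 ⟨Finset.mem_univ _, hN⟩)⟩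
  choose c hc hm using key
  exact ⟨⟨c, hc, hm⟩⟩

theorem isMatching_union {G : SimpleGraph V} [DecidableRel G.Adj] {h : History V}
    {M : Finset (Sym2 V)} (hA : IsMatching G (knownSuccesses h)) (hM : IsFreeMatching G h M) :
    IsMatching G (M ∪ knownSuccesses h) := by
  refine ⟨Finset.union_subset hM.1.1 hA.1, ?_⟩
  intro e he f hf hne v hve hvf
  rcases Finset.mem_union.1 he with he | he <;> rcases Finset.mem_union.1 hf with hf | hf
  · exact hM.1.2 e he f hf hne v hve hvf
  · exact hM.2 e he v hve f hf hvf
  · exact hM.2 f hf v hvf e he hve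
  · exact hA.2 e he f hf hne v hve hvf

/-- Greedy-Commit: in every round, select all edges known to be successful together with
a maximum-weight matching between the remaining vertices. -/
def greedyCommit {G : SimpleGraph V} [DecidableRel G.Adj] {p : Sym2 V → ℝ}
    (c : MaxWeightRule G p) : OnlineAlgorithm G where
  select h := c.choose h ∪ knownSuccesses h
  isMatching := by
    intro S _ t
    refine isMatching_union ?_ (c.isFreeMatching _)
    induction t with
    | zero => simp [run, knownSuccesses, IsMatching]
    | succ t ih =>
      have h1 := isMatching_union ih (c.isFreeMatching _)
      have hsub : knownSuccesses (run (fun h => c.choose h ∪ knownSuccesses h) S (t + 1)) ⊆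
          c.choose (run (fun h => c.choose h ∪ knownSuccesses h) S t) ∪
            knownSuccesses (run (fun h => c.choose h ∪ knownSuccesses h) S t) := by
        simp only [run, knownSuccesses]
        exact Finset.union_subset Finset.inter_subset_left Finset.subset_union_right
      exact ⟨hsub.trans h1.1, fun e he f hf => h1.2 e (hsub he) f (hsub hf)⟩

end

end RepeatedMatching

namespace RepeatedMatching

section

/-! ### Histories and explored edges -/

variable {V : Type*} [DecidableEq V]

/-! Let `a t` be the expected number of successes Greedy-Commit knows after `t` rounds. Since it
keeps every known success, its expected number of successes in round `n` is `a (n + 1)`; so it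
suffices to compare with any algorithm round by round, and the weights play no further role.

Let `b` be the other algorithm's expected number of successes in round `n`. For every `t`, at most
two of these edges per known success of Greedy-Commit touch that success. Each remaining one is
unexplored by Greedy-Commit and was first selected by the other algorithm in some round `s ≤ n`. For
fixed `s`, such edges form a free matching in which membership of an edge ignores its own outcome,
so their expected number of successes is at most the expected maximum weight, which is `a (t + 1) -
a t`. Thus `b ≤ 2 * a t + (n + 1) * (a (t + 1) - a t)` (`roundValue_le`), and iterating over `t`
gives `a (n + 1) ≥ (1 - exp (-2)) / 2 * b` (`mul_le_of_le_two_mul_add`). -/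

/-- The edges whose outcome has been observed. -/
def explored (h : History V) : Finset (Sym2 V) :=
  knownSuccesses h ∪ knownFailures h

theorem explored_run_succ (select : History V → Finset (Sym2 V)) (S : Finset (Sym2 V)) (t : ℕ) :
    explored (run select S (t + 1)) = select (run select S t) ∪ explored (run select S t) := by
  ext e
  simp only [explored, run, knownSuccesses, knownFailures, Finset.mem_union, Finset.mem_inter,
    Finset.mem_sdiff]
  tauto

theorem knownSuccesses_run_subset (select : History V → Finset (Sym2 V)) (S : Finset (Sym2 V))
    (t : ℕ) : knownSuccesses (run select S t) ⊆ S := by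
  induction t with
  | zero => simp [run, knownSuccesses]
  | succ t ih => exact Finset.union_subset Finset.inter_subset_right ih

theorem disjoint_knownFailures_run (select : History V → Finset (Sym2 V)) (S : Finset (Sym2 V))
    (t : ℕ) {e : Sym2 V} (he : e ∈ knownFailures (run select S t)) : e ∉ S := by
  induction t with
  | zero => simp [run, knownFailures] at he
  | succ t ih =>
    simp only [run, knownFailures, Finset.mem_union, Finset.mem_sdiff, Finset.mem_inter] at he
    tauto

theorem mem_knownSuccesses_of_mem_explored {select : History V → Finset (Sym2 V)}
    {S : Finset (Sym2 V)} {t : ℕ} {e : Sym2 V} (he : e ∈ explored (run select S t))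
    (heS : e ∈ S) : e ∈ knownSuccesses (run select S t) :=
  (Finset.mem_union.1 he).resolve_right fun h => disjoint_knownFailures_run _ _ _ h heS

/-- The history depends only on the outcomes of the explored edges. -/
theorem run_congr (select : History V → Finset (Sym2 V)) {S S' : Finset (Sym2 V)} {e : Sym2 V}
    (hS : ∀ f, f ≠ e → (f ∈ S ↔ f ∈ S')) :
    ∀ t, e ∉ explored (run select S t) → run select S' t = run select S t
  | 0, _ => rfl
  | t + 1, he => by
    rw [explored_run_succ, Finset.notMem_union] at he
    have ih := run_congr select hS t he.2
    have : select (run select S t) ∩ S' = select (run select S t) ∩ S := by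
      ext f
      simp only [Finset.mem_inter, and_congr_right_iff]
      exact fun hf => (hS f fun h => he.1 (h ▸ hf)).symm
    simp only [run, ih, this]

/-- Until `e` is explored its outcome cannot influence the run, so being unexplored in one of the
two runs already makes them coincide. This is the source of all independence below. -/
theorem run_insert (select : History V → Finset (Sym2 V)) {S : Finset (Sym2 V)} {e : Sym2 V}
    {t : ℕ} (he : e ∉ explored (run select S t) ∨ e ∉ explored (run select (insert e S) t)) :
    run select (insert e S) t = run select S t := by
  rcases he with he | he
  · exact run_congr select (fun f hf => by simp [hf]) t he
  · exact (run_congr select (fun f hf => by simp [hf]) t he).symm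

theorem exists_first_selection (select : History V → Finset (Sym2 V)) (S : Finset (Sym2 V))
    {e : Sym2 V} : ∀ n, e ∈ explored (run select S n) →
      ∃ s < n, e ∈ select (run select S s) ∧ e ∉ explored (run select S s)
  | 0, he => by simp [run, explored, knownSuccesses, knownFailures] at he
  | n + 1, he => by
    by_cases h : e ∈ explored (run select S n)
    · obtain ⟨s, hs, h'⟩ := exists_first_selection select S n h
      exact ⟨s, hs.trans n.lt_succ_self, h'⟩
    · rw [explored_run_succ, Finset.mem_union] at he
      exact ⟨n, n.lt_succ_self, he.resolve_right h, h⟩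

/-! ### Expectation over independent edge outcomes -/

variable [Fintype V]

/-- The expectation of `f` over the random set of successful edges. -/
def expectation (G : SimpleGraph V) [DecidableRel G.Adj] (p : Sym2 V → ℝ)
    (f : Finset (Sym2 V) → ℝ) : ℝ :=
  ∑ S ∈ G.edgeFinset.powerset, sampleProb G p S * f S

section Expectation

variable {G : SimpleGraph V} [DecidableRel G.Adj] {p : Sym2 V → ℝ}

theorem sampleProb_nonneg (hp : ∀ e ∈ G.edgeSet, 0 ≤ p e ∧ p e ≤ 1) {S : Finset (Sym2 V)}
    (hS : S ⊆ G.edgeFinset) : 0 ≤ sampleProb G p S := by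
  refine mul_nonneg (Finset.prod_nonneg fun e he => ?_) (Finset.prod_nonneg fun e he => ?_)
  · exact (hp e (SimpleGraph.mem_edgeFinset.1 (hS he))).1
  · exact sub_nonneg.2 (hp e (SimpleGraph.mem_edgeFinset.1 (Finset.mem_sdiff.1 he).1)).2

theorem expectation_mono (hp : ∀ e ∈ G.edgeSet, 0 ≤ p e ∧ p e ≤ 1)
    {f g : Finset (Sym2 V) → ℝ} (h : ∀ S ⊆ G.edgeFinset, f S ≤ g S) :
    expectation G p f ≤ expectation G p g :=
  Finset.sum_le_sum fun S hS => mul_le_mul_of_nonneg_left (h S (Finset.mem_powerset.1 hS))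
    (sampleProb_nonneg hp (Finset.mem_powerset.1 hS))

theorem expectation_congr {f g : Finset (Sym2 V) → ℝ} (h : ∀ S ⊆ G.edgeFinset, f S = g S) :
    expectation G p f = expectation G p g :=
  Finset.sum_congr rfl fun S hS => by rw [h S (Finset.mem_powerset.1 hS)]

theorem expectation_add (f g : Finset (Sym2 V) → ℝ) :
    expectation G p (fun S => f S + g S) = expectation G p f + expectation G p g := by
  simp only [expectation, mul_add, Finset.sum_add_distrib]

theorem expectation_const_mul (a : ℝ) (f : Finset (Sym2 V) → ℝ) :
    expectation G p (fun S => a * f S) = a * expectation G p f := by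
  simp only [expectation, Finset.mul_sum, mul_left_comm a]

theorem expectation_sum {ι : Type*} (s : Finset ι) (f : ι → Finset (Sym2 V) → ℝ) :
    expectation G p (fun S => ∑ i ∈ s, f i S) = ∑ i ∈ s, expectation G p (f i) := by
  simp only [expectation, Finset.mul_sum]
  exact Finset.sum_comm

/-- The outcome of an edge is independent of every quantity not depending on that outcome. -/
theorem expectation_mem_mul {e : Sym2 V} (he : e ∈ G.edgeFinset) {f : Finset (Sym2 V) → ℝ}
    (hf : ∀ S, e ∉ S → f (insert e S) = f S) :
    expectation G p (fun S => if e ∈ S then f S else 0) = p e * expectation G p f := by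
  obtain ⟨F, heF, hF⟩ : ∃ F, e ∉ F ∧ G.edgeFinset = insert e F :=
    ⟨_, Finset.notMem_erase e _, (Finset.insert_erase he).symm⟩
  have h1 : ∀ S ∈ F.powerset, sampleProb G p S =
      (1 - p e) * ((∏ i ∈ S, p i) * ∏ i ∈ F \ S, (1 - p i)) := by
    intro S hS
    have heS : e ∉ S := fun h => heF (Finset.mem_powerset.1 hS h)
    rw [sampleProb, hF, Finset.insert_sdiff_of_notMem _ heS,
      Finset.prod_insert (fun h => heF (Finset.mem_sdiff.1 h).1)]
    ring
  have h2 : ∀ S ∈ F.powerset, sampleProb G p (insert e S) =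
      p e * ((∏ i ∈ S, p i) * ∏ i ∈ F \ S, (1 - p i)) := by
    intro S hS
    have heS : e ∉ S := fun h => heF (Finset.mem_powerset.1 hS h)
    have : insert e F \ insert e S = F \ S := by
      ext x
      by_cases hx : x = e <;> simp [hx, heF]
    rw [sampleProb, hF, this, Finset.prod_insert heS]
    ring
  simp only [expectation]
  rw [hF, Finset.sum_powerset_insert heF, Finset.sum_powerset_insert heF, mul_add,
    Finset.mul_sum, Finset.mul_sum, ← Finset.sum_add_distrib, ← Finset.sum_add_distrib]
  refine Finset.sum_congr rfl fun S hS => ?_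
  have heS : e ∉ S := fun h => heF (Finset.mem_powerset.1 hS h)
  rw [if_neg heS, if_pos (Finset.mem_insert_self e S), hf S heS, h1 S hS, h2 S hS]
  ring

/-- If membership of each edge in the random set `N` does not depend on the outcome of that edge,
then the expected number of successes in `N` is its expected total probability. -/
theorem expectation_card_inter {N : Finset (Sym2 V) → Finset (Sym2 V)}
    (hN : ∀ S ⊆ G.edgeFinset, N S ⊆ G.edgeFinset)
    (hind : ∀ e S, e ∉ S → (e ∈ N (insert e S) ↔ e ∈ N S)) :
    expectation G p (fun S => ((N S ∩ S).card : ℝ)) =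
      expectation G p (fun S => ∑ e ∈ N S, p e) := by
  have hl : ∀ S ⊆ G.edgeFinset, ((N S ∩ S).card : ℝ) =
      ∑ e ∈ G.edgeFinset, if e ∈ S then (if e ∈ N S then (1 : ℝ) else 0) else 0 := by
    intro S hS
    have : N S ∩ S = G.edgeFinset.filter fun e => e ∈ S ∧ e ∈ N S := by
      ext e
      simp only [Finset.mem_inter, Finset.mem_filter]
      exact ⟨fun h => ⟨hS h.2, h.2, h.1⟩, fun h => ⟨h.2.2, h.2.1⟩⟩
    rw [this, Finset.card_filter, Nat.cast_sum]
    refine Finset.sum_congr rfl fun e _ => ?_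
    by_cases h1 : e ∈ S <;> by_cases h2 : e ∈ N S <;> simp [h1, h2]
  have hr : ∀ S ⊆ G.edgeFinset, ∑ e ∈ N S, p e =
      ∑ e ∈ G.edgeFinset, p e * (if e ∈ N S then (1 : ℝ) else 0) := by
    intro S hS
    simp only [mul_ite, mul_one, mul_zero]
    rw [← Finset.sum_filter, Finset.filter_mem_eq_inter, Finset.inter_eq_right.2 (hN S hS)]
  rw [expectation_congr hl, expectation_congr hr, expectation_sum, expectation_sum]
  refine Finset.sum_congr rfl fun e he => ?_
  rw [expectation_const_mul]
  exact expectation_mem_mul he fun S heS => by simp only [hind e S heS]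

end Expectation

/-- At most two edges of a matching meet each given edge. -/
theorem card_filter_meets_le {M A : Finset (Sym2 V)}
    (hM : ∀ e ∈ M, ∀ f ∈ M, e ≠ f → ∀ v, v ∈ e → v ∉ f) :
    (M.filter fun e => ∃ v ∈ e, ∃ f ∈ A, v ∈ f).card ≤ 2 * A.card := by
  classical
  have hverts : (A.biUnion Sym2.toFinset).card ≤ 2 * A.card := by
    rw [mul_comm]
    refine Finset.card_biUnion_le_card_mul _ _ _ fun f _ => ?_
    rw [Sym2.card_toFinset]
    split <;> omega
  refine le_trans ?_ hverts
  refine Finset.card_le_card_of_forall_subsingleton (fun e v => v ∈ e) (fun e he => ?_)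
    fun v _ e he f hf => ?_
  · obtain ⟨v, hv, f, hf, hvf⟩ := (Finset.mem_filter.1 he).2
    exact ⟨v, Finset.mem_biUnion.2 ⟨f, hf, Sym2.mem_toFinset.2 hvf⟩, hv⟩
  · by_contra hne
    exact hM e (Finset.mem_filter.1 he.1).1 f (Finset.mem_filter.1 hf.1).1 hne v he.2 hf.2

/-! ### Comparing Greedy-Commit with another algorithm -/

section GreedyCommit

variable {G : SimpleGraph V} [DecidableRel G.Adj] {p : Sym2 V → ℝ} (c : MaxWeightRule G p)

/-- The history of Greedy-Commit after `t` rounds. -/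
abbrev greedyHistory (S : Finset (Sym2 V)) (t : ℕ) : History V :=
  run (greedyCommit c).select S t

/-- The edges that `alg` selects for the first time in round `s`, that Greedy-Commit has not
explored in its first `t` rounds, and that avoid the edges known to Greedy-Commit to be
successful. -/
def freshEdges (alg : OnlineAlgorithm G) (s t : ℕ) (S : Finset (Sym2 V)) : Finset (Sym2 V) :=
  (alg.select (run alg.select S s)).filter fun e =>
    e ∉ explored (run alg.select S s) ∧ e ∉ explored (greedyHistory c S t) ∧
      ∀ v ∈ e, ∀ f ∈ knownSuccesses (greedyHistory c S t), v ∉ f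

theorem mem_freshEdges_insert (alg : OnlineAlgorithm G) (s t : ℕ) {e : Sym2 V}
    {S : Finset (Sym2 V)} :
    e ∈ freshEdges c alg s t (insert e S) ↔ e ∈ freshEdges c alg s t S := by
  simp only [freshEdges, Finset.mem_filter]
  constructor
  · rintro ⟨h1, h2, h3, h4⟩
    rw [run_insert _ (Or.inr h2)] at h1 h2
    rw [greedyHistory, run_insert _ (Or.inr h3)] at h4 h3
    exact ⟨h1, h2, h3, h4⟩
  · rintro ⟨h1, h2, h3, h4⟩
    rw [run_insert _ (Or.inl h2), greedyHistory, run_insert _ (Or.inl h3)]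
    exact ⟨h1, h2, h3, h4⟩

theorem isFreeMatching_freshEdges (alg : OnlineAlgorithm G) (s t : ℕ) {S : Finset (Sym2 V)}
    (hS : S ⊆ G.edgeFinset) :
    IsFreeMatching G (greedyHistory c S t) (freshEdges c alg s t S) := by
  have h := alg.isMatching S hS s
  refine ⟨⟨(Finset.filter_subset _ _).trans h.1, fun e he f hf => ?_⟩, fun e he => ?_⟩
  · exact h.2 e (Finset.mem_filter.1 he).1 f (Finset.mem_filter.1 hf).1
  · exact (Finset.mem_filter.1 he).2.2.2

/-- The weight of the matching that Greedy-Commit tries on the free vertices in round `t`. -/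
def greedyWeight (t : ℕ) (S : Finset (Sym2 V)) : ℝ :=
  ∑ e ∈ c.choose (greedyHistory c S t), residualProb p (greedyHistory c S t) e

/-- Fresh edges compete with the matching chosen by Greedy-Commit, and being unexplored they keep
their full probability as residual weight. -/
theorem expectation_freshEdges_le (hp : ∀ e ∈ G.edgeSet, 0 ≤ p e ∧ p e ≤ 1)
    (alg : OnlineAlgorithm G) (s t : ℕ) :
    expectation G p (fun S => ((freshEdges c alg s t S ∩ S).card : ℝ)) ≤
      expectation G p (greedyWeight c t) := by
  rw [expectation_card_inter (fun S hS => (isFreeMatching_freshEdges c alg s t hS).1.1)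
    fun e S _ => mem_freshEdges_insert c alg s t]
  refine expectation_mono hp fun S hS => ?_
  refine le_trans (Finset.sum_le_sum fun e he => le_of_eq ?_)
    (c.maximal _ _ (isFreeMatching_freshEdges c alg s t hS))
  have h := (Finset.mem_filter.1 he).2.2.1
  rw [explored, Finset.notMem_union] at h
  rw [residualProb, if_neg h.2]

theorem notMem_knownSuccesses_of_mem_choose {h : History V} {e : Sym2 V}
    (he : e ∈ c.choose h) : e ∉ knownSuccesses h := fun h' =>
  (c.isFreeMatching h).2 e he _ e.out_fst_mem e h' e.out_fst_mem

/-- The known successes after round `t` are the edges that earned a reward in round `t`. -/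
theorem knownSuccesses_greedyHistory_succ (S : Finset (Sym2 V)) (t : ℕ) :
    knownSuccesses (greedyHistory c S (t + 1)) =
      (greedyCommit c).select (greedyHistory c S t) ∩ S := by
  have h := knownSuccesses_run_subset (greedyCommit c).select S t
  refine Finset.union_eq_left.2 fun e he => Finset.mem_inter.2 ⟨?_, h he⟩
  exact Finset.mem_union_right _ he

theorem card_knownSuccesses_succ (S : Finset (Sym2 V)) (t : ℕ) :
    ((knownSuccesses (greedyHistory c S (t + 1))).card : ℝ) =
      (knownSuccesses (greedyHistory c S t)).card +
        ((c.choose (greedyHistory c S t) \ explored (greedyHistory c S t)) ∩ S).card := by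
  have hA := knownSuccesses_run_subset (greedyCommit c).select S t
  have hset : knownSuccesses (greedyHistory c S (t + 1)) =
      knownSuccesses (greedyHistory c S t) ∪
        ((c.choose (greedyHistory c S t) \ explored (greedyHistory c S t)) ∩ S) := by
    rw [knownSuccesses_greedyHistory_succ]
    ext e
    simp only [greedyCommit, Finset.mem_inter, Finset.mem_union, Finset.mem_sdiff]
    constructor
    · rintro ⟨h1 | h1, h2⟩
      · by_cases h3 : e ∈ explored (greedyHistory c S t)
        · exact Or.inl (mem_knownSuccesses_of_mem_explored h3 h2)
        · exact Or.inr ⟨⟨h1, h3⟩, h2⟩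
      · exact Or.inl h1
    · rintro (h1 | h1)
      · exact ⟨Or.inr h1, hA h1⟩
      · exact ⟨Or.inl h1.1.1, h1.2⟩
  rw [hset, Finset.card_union_of_disjoint, Nat.cast_add]
  refine Finset.disjoint_left.2 fun e he he' => ?_
  exact notMem_knownSuccesses_of_mem_choose c
    (Finset.mem_sdiff.1 (Finset.mem_inter.1 he').1).1 he

/-- The expected number of edges known to Greedy-Commit to be successful after `t` rounds. -/
def greedyValue (t : ℕ) : ℝ :=
  expectation G p fun S => ((knownSuccesses (greedyHistory c S t)).card : ℝ)

theorem greedyValue_zero : greedyValue c 0 = 0 := by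
  simp [greedyValue, expectation, run, knownSuccesses]

/-- The chosen matching may contain explored edges, but only known failures, whose residual weight
is zero. Whether an unexplored edge is chosen is independent of its outcome. -/
theorem greedyValue_succ (t : ℕ) :
    greedyValue c (t + 1) = greedyValue c t + expectation G p (greedyWeight c t) := by
  rw [greedyValue, expectation_congr fun S _ => card_knownSuccesses_succ c S t, expectation_add,
    ← greedyValue, add_right_inj, expectation_card_inter]
  · refine expectation_congr fun S _ => ?_
    rw [greedyWeight]
    refine Finset.sum_subset_zero_on_sdiff Finset.sdiff_subset (fun e he => ?_) fun e he => ?_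
    · rw [sdiff_sdiff_right_self, Finset.inf_eq_inter, Finset.mem_inter] at he
      have h := (Finset.mem_union.1 he.2).resolve_left
        (notMem_knownSuccesses_of_mem_choose c he.1)
      rw [residualProb, if_pos h]
    · have h := (Finset.mem_sdiff.1 he).2
      rw [explored, Finset.notMem_union] at h
      rw [residualProb, if_neg h.2]
  · exact fun S _ => Finset.sdiff_subset.trans (c.isFreeMatching _).1.1
  · intro e S _
    simp only [Finset.mem_sdiff]
    constructor
    · rintro ⟨h1, h2⟩
      rw [greedyHistory, run_insert _ (Or.inr h2)] at h1 h2
      exact ⟨h1, h2⟩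
    · rintro ⟨h1, h2⟩
      rw [greedyHistory, run_insert _ (Or.inl h2)]
      exact ⟨h1, h2⟩

/-- The expected number of successful edges that `alg` selects in round `n`. -/
def roundValue (p : Sym2 V → ℝ) (alg : OnlineAlgorithm G) (n : ℕ) : ℝ :=
  expectation G p fun S => ((alg.select (run alg.select S n) ∩ S).card : ℝ)

theorem card_select_inter_le (alg : OnlineAlgorithm G) (n t : ℕ) {S : Finset (Sym2 V)}
    (hS : S ⊆ G.edgeFinset) :
    (alg.select (run alg.select S n) ∩ S).card ≤
      2 * (knownSuccesses (greedyHistory c S t)).card +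
        ∑ s ∈ Finset.range (n + 1), (freshEdges c alg s t S ∩ S).card := by
  classical
  have hsub : alg.select (run alg.select S n) ∩ S ⊆
      ((alg.select (run alg.select S n)).filter fun e =>
        ∃ v ∈ e, ∃ f ∈ knownSuccesses (greedyHistory c S t), v ∈ f) ∪
      (Finset.range (n + 1)).biUnion fun s => freshEdges c alg s t S ∩ S := by
    intro e he
    obtain ⟨he1, he2⟩ := Finset.mem_inter.1 he
    by_cases hv : ∃ v ∈ e, ∃ f ∈ knownSuccesses (greedyHistory c S t), v ∈ f
    · exact Finset.mem_union_left _ (Finset.mem_filter.2 ⟨he1, hv⟩)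
    · refine Finset.mem_union_right _ (Finset.mem_biUnion.2 ?_)
      obtain ⟨s, hs, hs1, hs2⟩ := exists_first_selection alg.select S (n + 1) (e := e)
        (by rw [explored_run_succ]; exact Finset.mem_union_left _ he1)
      push Not at hv
      refine ⟨s, Finset.mem_range.2 hs, Finset.mem_inter.2
        ⟨Finset.mem_filter.2 ⟨hs1, hs2, fun hx => ?_, hv⟩, he2⟩⟩
      -- If Greedy-Commit had explored the successful edge `e`, then `e` would be a known success
      -- touching itself.
      exact hv _ e.out_fst_mem e (mem_knownSuccesses_of_mem_explored hx he2) e.out_fst_mem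
  refine (Finset.card_le_card hsub).trans ((Finset.card_union_le _ _).trans ?_)
  exact add_le_add (card_filter_meets_le (alg.isMatching S hS n).2)
    Finset.card_biUnion_le

theorem roundValue_le (hp : ∀ e ∈ G.edgeSet, 0 ≤ p e ∧ p e ≤ 1) (alg : OnlineAlgorithm G)
    (n t : ℕ) :
    roundValue p alg n ≤
      2 * greedyValue c t + (n + 1) * (greedyValue c (t + 1) - greedyValue c t) := by
  have h1 : roundValue p alg n ≤ expectation G p fun S =>
      2 * ((knownSuccesses (greedyHistory c S t)).card : ℝ) +
        ∑ s ∈ Finset.range (n + 1), ((freshEdges c alg s t S ∩ S).card : ℝ) :=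
    expectation_mono hp fun S hS => by exact_mod_cast card_select_inter_le c alg n t hS
  rw [expectation_add, expectation_const_mul, expectation_sum] at h1
  have h2 := Finset.sum_le_card_nsmul (Finset.range (n + 1)) _ _
    fun s _ => expectation_freshEdges_le c hp alg s t
  rw [Finset.card_range, nsmul_eq_mul, Nat.cast_add, Nat.cast_one] at h2
  rw [greedyValue_succ, add_sub_cancel_left]
  exact h1.trans (add_le_add le_rfl h2)

end GreedyCommit

/-! ### The recursion and the constant -/

/-- A sequence that in every step gains at least the fraction `1 / n` of `b` minus twice its
current value reaches more than `0.43 * b` in `n` steps. -/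
theorem mul_le_of_le_two_mul_add {a : ℕ → ℝ} {b : ℝ} (hb : 0 ≤ b) (h0 : a 0 = 0) {n : ℕ}
    (hn : 1 ≤ n) (h : ∀ t, b ≤ 2 * a t + n * (a (t + 1) - a t)) : 0.43 * b ≤ a n := by
  -- For `n = 1` the contraction factor `1 - 2 / n` is negative, but then one step already gives `b
  -- ≤ a 1`.
  obtain rfl | hn2 := hn.eq_or_lt
  · have := h 0
    norm_num [h0] at this ⊢
    linarith
  have hn0 : (2 : ℝ) ≤ n := by exact_mod_cast hn2
  have hnpos : (0 : ℝ) < n := by linarith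
  have hr : 0 ≤ 1 - 2 / (n : ℝ) := sub_nonneg.2 ((div_le_one hnpos).2 hn0)
  -- `b / 2` is the fixed point of the recursion.
  have key : ∀ t, b / 2 - a t ≤ (1 - 2 / (n : ℝ)) ^ t * (b / 2) := by
    intro t
    induction t with
    | zero => simp [h0]
    | succ t ih =>
      have h1 : (b - 2 * a t) / n ≤ a (t + 1) - a t := by
        rw [div_le_iff₀ hnpos]
        linarith [h t]
      calc b / 2 - a (t + 1) ≤ b / 2 - a t - (b - 2 * a t) / n := by linarith
        _ = (1 - 2 / (n : ℝ)) * (b / 2 - a t) := by ring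
        _ ≤ (1 - 2 / (n : ℝ)) * ((1 - 2 / (n : ℝ)) ^ t * (b / 2)) :=
          mul_le_mul_of_nonneg_left ih hr
        _ = (1 - 2 / (n : ℝ)) ^ (t + 1) * (b / 2) := by ring
  -- `0.43 = (1 - 0.14) / 2`; the bound follows from `exp 2 > 2.7 ^ 2 = 7.29 > 1 / 0.14`.
  have hexp : (1 - 2 / (n : ℝ)) ^ n ≤ 0.14 := by
    refine (Real.one_sub_div_pow_le_exp_neg hn0).trans ?_
    have he : (2.7 : ℝ) < Real.exp 1 := lt_trans (by norm_num) Real.exp_one_gt_d9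
    have h2 : Real.exp 2 = Real.exp 1 * Real.exp 1 := by rw [← Real.exp_add]; norm_num
    rw [Real.exp_neg, inv_le_comm₀ (Real.exp_pos 2) (by norm_num), h2]
    norm_num at he ⊢
    nlinarith
  have := (key n).trans (mul_le_mul_of_nonneg_right hexp (by linarith))
  norm_num at this ⊢
  linarith

theorem OnlineAlgorithm.expectedReward_eq {G : SimpleGraph V} [DecidableRel G.Adj]
    (alg : OnlineAlgorithm G) (p : Sym2 V → ℝ) (T : ℕ) (w : ℕ → ℝ) :
    alg.expectedReward p T w = ∑ t ∈ Finset.range T, w t * roundValue p alg t := by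
  simp only [roundValue, ← expectation_const_mul]
  rw [← expectation_sum]
  rfl

theorem mul_roundValue_le {G : SimpleGraph V} [DecidableRel G.Adj] {p : Sym2 V → ℝ}
    (hp : ∀ e ∈ G.edgeSet, 0 ≤ p e ∧ p e ≤ 1) (c : MaxWeightRule G p)
    (alg : OnlineAlgorithm G) (t : ℕ) :
    0.43 * roundValue p alg t ≤ roundValue p (greedyCommit c) t := by
  have hgreedy : roundValue p (greedyCommit c) t = greedyValue c (t + 1) := by
    simp only [greedyValue, knownSuccesses_greedyHistory_succ]
    rfl
  rw [hgreedy]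
  -- The other algorithm's round `t` stays fixed while Greedy-Commit's round `k` varies.
  refine mul_le_of_le_two_mul_add ?_ (greedyValue_zero c) (Nat.le_add_left 1 t) fun k => ?_
  · exact Finset.sum_nonneg fun S hS =>
      mul_nonneg (sampleProb_nonneg hp (Finset.mem_powerset.1 hS)) (Nat.cast_nonneg _)
  · rw [Nat.cast_add, Nat.cast_one]
    exact roundValue_le c hp alg t k

end

end RepeatedMatching

theorem theorem2 {V : Type*} [Fintype V] [DecidableEq V]
    (G : SimpleGraph V) [DecidableRel G.Adj]
    (p : Sym2 V → ℝ) (hp : ∀ e ∈ G.edgeSet, 0 ≤ p e ∧ p e ≤ 1)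
    (T : ℕ) (w : ℕ → ℝ) (hw : ∀ t, 0 ≤ w t)
    (c : RepeatedMatching.MaxWeightRule G p) :
    (0.43 : ℝ) * RepeatedMatching.optReward G p T w ≤
      (RepeatedMatching.greedyCommit c).expectedReward p T w := by
  have : Nonempty (RepeatedMatching.OnlineAlgorithm G) := ⟨RepeatedMatching.greedyCommit c⟩
  rw [mul_comm, ← le_div_iff₀ (by norm_num)]
  refine ciSup_le fun alg => ?_
  rw [le_div_iff₀ (by norm_num), mul_comm, alg.expectedReward_eq,
    RepeatedMatching.OnlineAlgorithm.expectedReward_eq, Finset.mul_sum]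
  refine Finset.sum_le_sum fun t _ => ?_
  rw [mul_left_comm]
  exact mul_le_mul_of_nonneg_left (RepeatedMatching.mul_roundValue_le hp c alg t) (hw t)
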